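/- For $t\in\{1,\dots,T\}$, $T\ge 1$, let $\mathcal M_t=\langle\mathcal S_t,\mathcal A_t,\mathcal P_t,\mathcal R_t,\gamma_t\rangle$ be a Markov decision process with measurable state and action spaces, transition kernel $\mathcal P_t(\cdot\mid s,a)$, measurable reward function with $|\mathcal R_t(s,a,s')|\le R_{\max,t}$, and discount factor $\gamma_t\in(0,1)$. Policies are measurable maps $\pi:\mathcal S_t\to\mathcal A_t$; $P_t^{\pi}$ denotes the Markov kernel $(s,a)\mapsto(s',\pi(s'))$, $s'\sim\mathcal P_t(\cdot\mid s,a)$, and $Q_t^\pi(s,a)=\mathbb E\big[\sum_{k\ge0}\gamma_t^k r_{k+1}\mid s_0=s,a_0=a,\pi\big]$. Let $Q_t^*$ be the optimal action-value function, i.e. the bounded measurable solution of $Q=\mathcal T_t^*Q$, where $(\mathcal T^*_tQ)(s,a)=\int\big[\mathcal R_t(s,a,s')+\gamma_t\sup_{a'}Q(s',a')\big]\mathcal P_t(ds'\mid s,a)$, and let $\pi_t^*$ be an optimal policy, i.e. one that is greedy for $Q_t^*$ (both are assumed to exist). A policy $\pi$ is greedy for $Q$ if $Q(s,\pi(s))=\max_aQ(s,a)$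 for all $s$. Let $\rho_t,\nu_t$ be probability measures on $\mathcal S_t\times\mathcal A_t$, and put $\gamma=\max_t\gamma_t$, $R_{\max,\mathrm{avg}}=\frac1T\sum_tR_{\max,t}$. For a probability measure $\mu$ let $c_t(\mu)=\big(\int|d\mu/d\nu_t|^2\,d\nu_t\big)^{1/2}$ if $\mu\ll\nu_t$, and $c_t(\mu)=\infty$ otherwise. Put $c_{1,t}(m_1,m_2;\pi)=c_t\big(\rho_t(P_t^{\pi_t^*})^{m_1}(P_t^{\pi})^{m_2}\big)$, $c_{2,t}(m_1,m_2;\pi,\pi')=c_t\big(\rho_t(P_t^{\pi_t^*})^{m_1}(P_t^{\pi})^{m_2}P_t^{\pi'}\big)$, $c_{3,t}(m)=c_t\big(\rho_t(P_t^{\pi_t^*})^{m}\big)$. Let $K\ge1$, $\alpha_k(\beta)=\frac{(1-\beta)\beta^{K-k-1}}{1-\beta^{K+1}}$ for $0\le k<K$, $\beta\in(0,1)$, and $$C_{\mathrm{PI}}(K;t,r)=\Big(\frac{1-\gamma_t}{2}\Big)^2\sup_{\pi'_0,\dots,\pi'_K}\sum_{k=0}^{K-1}\alpha_k(\gamma_t)^{2(1-r)}\Big(\sum_{m\ge0}\gamma_t^m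 c_{1,t}(K-k-1,m+1;\pi'_{k+1})+\sum_{m\ge1}\gamma_t^m c_{2,t}(K-k-1,m;\pi'_{k+1},\pi'_k)+c_{3,t}(K-k)\Big)^2,$$ the supremum being over policies of task $t$, and $C_{\mathrm{PI}}^{1/2}(K;r)=\max_tC_{\mathrm{PI}}^{1/2}(K;t,r)$. Theorem. Let $Q_{\max}\le\frac{\max_tR_{\max,t}}{1-\gamma}$. For each $t$ let $Q_{t,0},\dots,Q_{t,K-1}$ be measurable functions on $\mathcal S_t\times\mathcal A_t$ bounded by $Q_{\max}$, let $\pi_{t,0}$ be any policy, and for $0\le k<K$ let $\pi_{t,k+1}$ be a policy that is greedy for $Q_{t,k}$. Let $\varepsilon_{\mathrm{avg},k}=\frac1T\sum_{t=1}^T\|Q_{t,k}-Q_t^{\pi_{t,k}}\|_{2,\nu_t}^2$ and $\mathcal E_{\mathrm{avg}}(r)=\sum_{k=0}^{K-1}\alpha_k(\gamma)^{2r}\varepsilon_{\mathrm{avg},k}$. Then $$\frac1T\sum_{t=1}^T\|Q_t^*-Q_t^{\pi_{t,K}}\|_{1,\rho_t}\le\frac{2\gamma}{(1-\gamma)^2}\Big[\inf_{r\in[0,1]}C_{\mathrm{PI}}^{1/2}(K;r)\,\mathcal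 E_{\mathrm{avg}}^{1/2}(r)+\gamma^{K-1}R_{\max,\mathrm{avg}}\Big],$$ where the product in the infimum is read as $\infty$ whenever $C_{\mathrm{PI}}(K;r)=\infty$. -/

import Mathlib

open MeasureTheory ProbabilityTheory Set
open scoped ENNReal

noncomputable section

namespace MTRL

/-- A discounted Markov decision process: transition kernel `P(· | s, a)`, measurable reward
function `R (s, a) s'`, discount factor in `(0, 1)`. -/
structure MDP (S A : Type*) [MeasurableSpace S] [MeasurableSpace A] where
  P : Kernel (S × A) S
  markov : IsMarkovKernel P
  R : S × A → S → ℝ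
  measurable_R : Measurable (Function.uncurry R)
  γ : ℝ
  γ_pos : 0 < γ
  γ_lt_one : γ < 1

/-- Deterministic stationary policies: measurable maps from states to actions. -/
def Policy (S A : Type*) [MeasurableSpace S] [MeasurableSpace A] : Type _ :=
  {π : S → A // Measurable π}

/-- `Q ∈ B(X, L)`: measurable and bounded by `L`. -/
def BddMeas {X : Type*} [MeasurableSpace X] (L : ℝ) (Q : X → ℝ) : Prop :=
  Measurable Q ∧ ∀ x, |Q x| ≤ L

/-- `π` is greedy with respect to `Q`: `Q (s, π s) = max_a Q (s, a)` for every state `s`. -/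
def IsGreedy {S A : Type*} [MeasurableSpace S] [MeasurableSpace A]
    (Q : S × A → ℝ) (π : Policy S A) : Prop :=
  ∀ s a, Q (s, a) ≤ Q (s, π.1 s)

namespace MDP

variable {S A : Type*} [MeasurableSpace S] [MeasurableSpace A]

/-- The state-action transition kernel `P^π`: from `(s, a)` move to `(s', π s')` with
`s' ∼ P(· | s, a)`. -/
def Pπ (M : MDP S A) (π : Policy S A) : Kernel (S × A) (S × A) :=
  M.P.map (fun s' => (s', π.1 s'))

/-- The measure `μ (P^π)^m`: the law of the state-action pair after `m` steps under `π`, when the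
initial pair has law `μ`. -/
def future (M : MDP S A) (π : Policy S A) (m : ℕ) (μ : Measure (S × A)) : Measure (S × A) :=
  (fun μ' : Measure (S × A) => μ'.bind (M.Pπ π))^[m] μ

/-- Expected immediate reward `r(s, a) = ∫ R(s, a, s') P(ds' | s, a)`. -/
def expReward (M : MDP S A) (x : S × A) : ℝ := ∫ s', M.R x s' ∂(M.P x)

/-- The action-value function `Q^π(s, a)`: the expected discounted cumulative reward
`∑_k γ^k E[r_{k+1}]` when starting from `(s, a)` and following `π` thereafter; the pair at time `k`
has law `δ_{(s, a)} (P^π)^k`. -/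
def Qval (M : MDP S A) (π : Policy S A) (x : S × A) : ℝ :=
  ∑' k : ℕ, M.γ ^ k * ∫ y, M.expReward y ∂(M.future π k (Measure.dirac x))

/-- The optimal Bellman operator `T*`. -/
def bellmanOpt (M : MDP S A) (Q : S × A → ℝ) (x : S × A) : ℝ :=
  ∫ s', (M.R x s' + M.γ * ⨆ a', Q (s', a')) ∂(M.P x)

/-- `Q` is the optimal action-value function `Q*`: the bounded measurable solution of the Bellman
optimality equation `Q = T* Q`. -/
def IsOptimalValue (M : MDP S A) (Q : S × A → ℝ) : Prop :=
  (∃ L, BddMeas L Q) ∧ M.bellmanOpt Q = Q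

end MDP

/-- `(E_{X ∼ ν} |dμ/dν (X)|²)^{1/2}`, and `∞` if `μ` is not absolutely continuous w.r.t. `ν`. -/
def conc {X : Type*} [MeasurableSpace X] (μ ν : Measure X) : ℝ≥0∞ :=
  open Classical in
  if μ ≪ ν then (∫⁻ x, (μ.rnDeriv ν x) ^ 2 ∂ν) ^ (1 / 2 : ℝ) else ⊤

/-- The weights `α_k`, `0 ≤ k ≤ K`, for the discount factor `γ`. -/
def alpha (γ : ℝ) (K k : ℕ) : ℝ :=
  if k < K then (1 - γ) * γ ^ (K - k - 1) / (1 - γ ^ (K + 1))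
  else (1 - γ) * γ ^ K / (1 - γ ^ (K + 1))

namespace MDP

variable {S A : Type*} [MeasurableSpace S] [MeasurableSpace A]

/-- `c_{PI₁,ρ,ν}(m₁, m₂; π)`: the coefficient of `ρ (P^{π*})^{m₁} (P^π)^{m₂}`. -/
def cPI1 (M : MDP S A) (πstar : Policy S A) (ρ ν : Measure (S × A)) (m₁ m₂ : ℕ)
    (π : Policy S A) : ℝ≥0∞ :=
  conc (M.future π m₂ (M.future πstar m₁ ρ)) ν

/-- `c_{PI₂,ρ,ν}(m₁, m₂; π₁, π₂)`: the coefficient of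
`ρ (P^{π*})^{m₁} (P^{π₁})^{m₂} P^{π₂}`. -/
def cPI2 (M : MDP S A) (πstar : Policy S A) (ρ ν : Measure (S × A)) (m₁ m₂ : ℕ)
    (π₁ π₂ : Policy S A) : ℝ≥0∞ :=
  conc (M.future π₂ 1 (M.future π₁ m₂ (M.future πstar m₁ ρ))) ν

/-- `c_{PI₃,ρ,ν}(m)`: the coefficient of `ρ (P^{π*})^m`. -/
def cPI3 (M : MDP S A) (πstar : Policy S A) (ρ ν : Measure (S × A)) (m : ℕ) : ℝ≥0∞ :=
  conc (M.future πstar m ρ) ν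

/-- The concentrability constant `C_{PI,ρ,ν}(K; r)` of one task. The sum over `m ≥ 1` is written
with the index shifted by one. -/
def CPI (M : MDP S A) (πstar : Policy S A) (ρ ν : Measure (S × A)) (K : ℕ) (r : ℝ) : ℝ≥0∞ :=
  ENNReal.ofReal (((1 - M.γ) / 2) ^ 2) *
    ⨆ π' : Fin (K + 1) → Policy S A,
      ∑ k : Fin K, ENNReal.ofReal (alpha M.γ K k) ^ (2 * (1 - r)) *
        ((∑' m : ℕ, ENNReal.ofReal M.γ ^ m *
            M.cPI1 πstar ρ ν (K - k - 1) (m + 1) (π' k.succ))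
          + (∑' m : ℕ, ENNReal.ofReal M.γ ^ (m + 1) *
            M.cPI2 πstar ρ ν (K - k - 1) (m + 1) (π' k.succ) (π' k.castSucc))
          + M.cPI3 πstar ρ ν (K - k)) ^ 2

end MDP

section MultiTask

variable {T : ℕ} {S A : Fin T → Type*}
  [∀ t, MeasurableSpace (S t)] [∀ t, MeasurableSpace (A t)]

/-- `γ = max_t γ_t`. -/
def gammaMax (M : ∀ t, MDP (S t) (A t)) : ℝ := ⨆ t, (M t).γ

/-- `C_PI^{1/2}(K; r) = max_t C_{PI,ρ,ν}^{1/2}(K; t, r)`. -/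
def sqrtCPI (M : ∀ t, MDP (S t) (A t)) (πstar : ∀ t, Policy (S t) (A t))
    (ρ ν : ∀ t, Measure (S t × A t)) (K : ℕ) (r : ℝ) : ℝ≥0∞ :=
  ⨆ t, ((M t).CPI (πstar t) (ρ t) (ν t) K r) ^ (1 / 2 : ℝ)

/-- `ε_{avg,k} = (1/T) ∑_t ‖Q_{t,k} - Q_t^{π_k}‖²_ν`. -/
def epsAvg (M : ∀ t, MDP (S t) (A t)) (ν : ∀ t, Measure (S t × A t))
    (Q : ∀ t, ℕ → S t × A t → ℝ) (π : ∀ t, ℕ → Policy (S t) (A t)) (k : ℕ) : ℝ≥0∞ :=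
  (∑ t, eLpNorm (fun x => Q t k x - (M t).Qval (π t k) x) 2 (ν t) ^ 2) / (T : ℝ≥0∞)

/-- `E_avg(ε_{avg,0}, …, ε_{avg,K-1}; r) = ∑_{k<K} α_k^{2r} ε_{avg,k}`. -/
def errAvg (γ : ℝ) (K : ℕ) (ε : ℕ → ℝ≥0∞) (r : ℝ) : ℝ≥0∞ :=
  ∑ k ∈ Finset.range K, ENNReal.ofReal (alpha γ K k) ^ (2 * r) * ε k

end MultiTask

end MTRL

end

/-! ### Bounded functions and discounted inequalities -/

namespace MTRL

/-! Fix a task and write `V₀`, `V₁` for the values of two successive policies, `e = Q - V₀`, and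
`P₀`, `P₁`, `P*` for the kernels of `π₀`, `π₁`, `πstar`. Since `π₁` is greedy for `Q`, both `P₀ Q`
and `P* Q` are at most `P₁ Q`. With the Bellman equations this gives, for `h = Q - V₁`, the bounds
`h ≤ |e| + γ P₀|e| + γ P₁ h` (`value_gap_le`) and `Q* - V₁ ≤ γ P*(Q* - V₀) + γ P₁ h + γ P*|e|`
(`optimality_gap_le`).

Unrolling the first bound (`lintegral_le_tsum_future`) and integrating the second against `ρ (P*)^j`
leaves integrals of `|e|` against exactly the measures in the coefficients `cPI1`, `cPI2`, `cPI3`.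
Cauchy–Schwarz with respect to `ν` turns each into a coefficient times the L² error. Iterating over
`k` gives a sum with weights `γ_t^(K-k)` (`MDP.eLpNorm_optimality_gap_le`).

These weights are at most `γ_t/(1-γ_t) α_k(γ_t)`. Splitting `α_k = α_k^(1-r) α_k^r` and applying
Cauchy–Schwarz over `k` separates `CPI` from the errors. Passing from `γ_t` to the maximal `γ` is
delicate because `α_k` need not be monotone; multiplied by `x/(1-x)^2`, its `r`-th power is
(`div_sq_mul_alpha_rpow_mono`). Concavity of the square root then averages the tasks. -/

lemma BddMeas.integrable {X : Type*} [MeasurableSpace X] {L : ℝ} {f : X → ℝ}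
    (hf : BddMeas L f) (μ : Measure X) [IsFiniteMeasure μ] : Integrable f μ :=
  Integrable.of_bound hf.1.aestronglyMeasurable L
    (Filter.Eventually.of_forall fun x => by simpa using hf.2 x)

lemma BddMeas.abs_integral_le {X : Type*} [MeasurableSpace X] {L : ℝ} {f : X → ℝ}
    (hf : BddMeas L f) (μ : Measure X) [IsProbabilityMeasure μ] : |∫ x, f x ∂μ| ≤ L := by
  have h := norm_integral_le_of_norm_le_const (μ := μ) (f := f) (C := L)
    (Filter.Eventually.of_forall fun x => by simpa using hf.2 x)
  simpa using h

lemma BddMeas.sub {X : Type*} [MeasurableSpace X] {L L' : ℝ} {f g : X → ℝ}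
    (hf : BddMeas L f) (hg : BddMeas L' g) : BddMeas (L + L') (fun x => f x - g x) :=
  ⟨hf.1.sub hg.1, fun x => (abs_sub _ _).trans (add_le_add (hf.2 x) (hg.2 x))⟩

lemma BddMeas.add {X : Type*} [MeasurableSpace X] {L L' : ℝ} {f g : X → ℝ}
    (hf : BddMeas L f) (hg : BddMeas L' g) : BddMeas (L + L') (fun x => f x + g x) :=
  ⟨hf.1.add hg.1, fun x => (abs_add_le _ _).trans (add_le_add (hf.2 x) (hg.2 x))⟩

lemma BddMeas.abs {X : Type*} [MeasurableSpace X] {L : ℝ} {f : X → ℝ}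
    (hf : BddMeas L f) : BddMeas L (fun x => |f x|) :=
  ⟨hf.1.abs, fun x => by simpa using hf.2 x⟩

/-- A bounded function that is a sub-solution of an affine discounted equation with constant
inhomogeneity `c` is bounded by `c / (1 - γ)`. -/
lemma le_div_of_le_discounted {X : Type*} [MeasurableSpace X] (κ : X → Measure X)
    [∀ x, IsProbabilityMeasure (κ x)] {γ c L : ℝ} (h0 : 0 ≤ γ) (h1 : γ < 1)
    {f : X → ℝ} (hf : BddMeas L f) (h : ∀ x, f x ≤ c + γ * ∫ y, f y ∂(κ x)) (x : X) :
    f x ≤ c / (1 - γ) := by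
  have hbdd : BddAbove (range f) := ⟨L, by rintro _ ⟨y, rfl⟩; exact (le_abs_self _).trans (hf.2 y)⟩
  have : Nonempty X := ⟨x⟩
  -- The supremum itself satisfies the inequality; as it is finite, it can be solved for.
  have hs : ⨆ y, f y ≤ c + γ * ⨆ y, f y := by
    refine ciSup_le fun y => (h y).trans ?_
    gcongr
    calc ∫ z, f z ∂(κ y) ≤ ∫ _, (⨆ y, f y) ∂(κ y) :=
          integral_mono (hf.integrable _) (integrable_const _) fun z => le_ciSup hbdd z
      _ = ⨆ y, f y := by simp
  refine (le_ciSup hbdd x).trans ?_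
  rw [le_div_iff₀ (by linarith)]
  linarith

/-! ### Transition laws, Bellman equations and optimality -/

namespace MDP

variable {S A : Type*} [MeasurableSpace S] [MeasurableSpace A]

attribute [instance] MDP.markov

lemma measurable_graph (π : Policy S A) : Measurable (fun s : S => (s, π.1 s)) :=
  measurable_id.prodMk π.2

instance (M : MDP S A) (π : Policy S A) : IsMarkovKernel (M.Pπ π) :=
  Kernel.IsMarkovKernel.map _ (measurable_graph π)

lemma integral_Pπ (M : MDP S A) (π : Policy S A) {f : S × A → ℝ} (hf : Measurable f)
    (x : S × A) : ∫ y, f y ∂(M.Pπ π x) = ∫ s, f (s, π.1 s) ∂(M.P x) := by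
  rw [Pπ, Kernel.map_apply _ (measurable_graph π),
    integral_map (measurable_graph π).aemeasurable hf.aestronglyMeasurable]

/-- Greedy policies maximise the expected next value. -/
lemma integral_Pπ_le_of_isGreedy (M : MDP S A) {L : ℝ} {f : S × A → ℝ} (hf : BddMeas L f)
    {π : Policy S A} (hπ : IsGreedy f π) (π' : Policy S A) (x : S × A) :
    ∫ y, f y ∂(M.Pπ π' x) ≤ ∫ y, f y ∂(M.Pπ π x) := by
  rw [M.integral_Pπ π' hf.1, M.integral_Pπ π hf.1]
  have hb : ∀ π : Policy S A, BddMeas L (fun s => f (s, π.1 s)) := fun π =>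
    ⟨hf.1.comp (measurable_graph π), fun s => hf.2 _⟩
  exact integral_mono ((hb π').integrable _) ((hb π).integrable _) fun s => hπ s _

lemma future_zero (M : MDP S A) (π : Policy S A) (μ : Measure (S × A)) :
    M.future π 0 μ = μ := rfl

lemma future_succ (M : MDP S A) (π : Policy S A) (m : ℕ) (μ : Measure (S × A)) :
    M.future π (m + 1) μ = M.future π m (μ.bind (M.Pπ π)) := rfl

lemma future_succ' (M : MDP S A) (π : Policy S A) (m : ℕ) (μ : Measure (S × A)) :
    M.future π (m + 1) μ = (M.future π m μ).bind (M.Pπ π) :=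
  Function.iterate_succ_apply' _ _ _

lemma future_one (M : MDP S A) (π : Policy S A) (μ : Measure (S × A)) :
    M.future π 1 μ = μ.bind (M.Pπ π) := rfl

instance (M : MDP S A) (π : Policy S A) (m : ℕ) (μ : Measure (S × A))
    [IsProbabilityMeasure μ] : IsProbabilityMeasure (M.future π m μ) := by
  induction m with
  | zero => assumption
  | succ m ih => rw [future_succ']; infer_instance

lemma lintegral_future_succ (M : MDP S A) (π : Policy S A) (m : ℕ) (μ : Measure (S × A))
    {f : S × A → ℝ≥0∞} (hf : Measurable f) :
    ∫⁻ x, f x ∂(M.future π (m + 1) μ) = ∫⁻ x, ∫⁻ y, f y ∂(M.Pπ π x) ∂(M.future π m μ) := by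
  rw [future_succ', Measure.lintegral_bind (Kernel.aemeasurable _) hf.aemeasurable]

lemma lintegral_future_one (M : MDP S A) (π : Policy S A) (μ : Measure (S × A))
    {f : S × A → ℝ≥0∞} (hf : Measurable f) :
    ∫⁻ x, f x ∂(M.future π 1 μ) = ∫⁻ x, ∫⁻ y, f y ∂(M.Pπ π x) ∂μ := by
  rw [future_one, Measure.lintegral_bind (Kernel.aemeasurable _) hf.aemeasurable]

/-- The `m`-step transition kernel of a policy. -/
noncomputable def futureKernel (M : MDP S A) (π : Policy S A) : ℕ → Kernel (S × A) (S × A)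
  | 0 => Kernel.id
  | m + 1 => M.Pπ π ∘ₖ futureKernel M π m

instance (M : MDP S A) (π : Policy S A) (m : ℕ) : IsMarkovKernel (M.futureKernel π m) := by
  induction m with
  | zero => rw [futureKernel]; infer_instance
  | succ m ih => rw [futureKernel]; infer_instance

/-- Realising the iterated law by a kernel supplies measurability in the initial state-action pair.
-/
lemma future_eq_bind (M : MDP S A) (π : Policy S A) (m : ℕ) (μ : Measure (S × A)) :
    M.future π m μ = μ.bind (M.futureKernel π m) := by
  induction m with
  | zero => simp [future_zero, futureKernel]
  | succ m ih => rw [future_succ', ih, futureKernel, Measure.comp_assoc]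

lemma future_dirac (M : MDP S A) (π : Policy S A) (m : ℕ) (x : S × A) :
    M.future π m (Measure.dirac x) = M.futureKernel π m x := by
  rw [future_eq_bind, Measure.dirac_bind (Kernel.measurable _)]

/-- Splitting off the first transition is what identifies the shifted value series in the Bellman
equation. -/
lemma future_succ_dirac (M : MDP S A) (π : Policy S A) (m : ℕ) (x : S × A) :
    M.future π (m + 1) (Measure.dirac x) = (M.Pπ π x).bind (M.futureKernel π m) := by
  rw [future_succ, Measure.dirac_bind (Kernel.measurable _), future_eq_bind]

variable {M : MDP S A} {Rmax : ℝ}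

lemma bddMeas_expReward (hR : ∀ x s', |M.R x s'| ≤ Rmax) : BddMeas Rmax M.expReward := by
  refine ⟨?_, fun x => ?_⟩
  · exact (M.measurable_R.stronglyMeasurable.integral_kernel_prod_right' (κ := M.P)).measurable
  · exact BddMeas.abs_integral_le ⟨M.measurable_R.comp measurable_prodMk_left, hR x⟩ _

lemma bddMeas_integral_futureKernel (π : Policy S A) (m : ℕ) {L : ℝ} {f : S × A → ℝ}
    (hf : BddMeas L f) : BddMeas L (fun x => ∫ y, f y ∂(M.futureKernel π m x)) :=
  ⟨(hf.1.stronglyMeasurable.integral_kernel (κ := M.futureKernel π m)).measurable,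
    fun _ => hf.abs_integral_le _⟩

lemma abs_Qval_term_le (hR : ∀ x s', |M.R x s'| ≤ Rmax) (π : Policy S A) (k : ℕ) (x : S × A) :
    ‖M.γ ^ k * ∫ y, M.expReward y ∂(M.futureKernel π k x)‖ ≤ M.γ ^ k * Rmax := by
  rw [norm_mul, norm_pow, Real.norm_of_nonneg M.γ_pos.le]
  have := M.γ_pos.le
  gcongr
  exact (bddMeas_integral_futureKernel π k (bddMeas_expReward hR)).2 x

lemma summable_γ_mul (M : MDP S A) (c : ℝ) : Summable fun k => M.γ ^ k * c :=
  (summable_geometric_of_lt_one M.γ_pos.le M.γ_lt_one).mul_right c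

lemma summable_Qval (hR : ∀ x s', |M.R x s'| ≤ Rmax) (π : Policy S A) (x : S × A) :
    Summable fun k => M.γ ^ k * ∫ y, M.expReward y ∂(M.futureKernel π k x) :=
  Summable.of_norm_bounded (M.summable_γ_mul Rmax) fun k => abs_Qval_term_le hR π k x

lemma Qval_eq (M : MDP S A) (π : Policy S A) (x : S × A) :
    M.Qval π x = ∑' k : ℕ, M.γ ^ k * ∫ y, M.expReward y ∂(M.futureKernel π k x) := by
  simp_rw [Qval, future_dirac]

lemma bddMeas_Qval (hR : ∀ x s', |M.R x s'| ≤ Rmax) (π : Policy S A) :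
    BddMeas (Rmax / (1 - M.γ)) (M.Qval π) := by
  refine ⟨?_, fun x => ?_⟩
  · rw [show M.Qval π = _ from funext (M.Qval_eq π)]
    refine Measurable.tsum fun k => ?_
    exact (bddMeas_integral_futureKernel π k (bddMeas_expReward hR)).1.const_mul _
  · rw [Qval_eq]
    have h := tsum_of_norm_bounded (M.summable_γ_mul Rmax).hasSum
      fun k => abs_Qval_term_le hR π k x
    rwa [tsum_mul_right, tsum_geometric_of_lt_one M.γ_pos.le M.γ_lt_one, inv_mul_eq_div] at h

/-- The Bellman equation of a policy. -/
lemma Qval_bellman (hR : ∀ x s', |M.R x s'| ≤ Rmax) (π : Policy S A) (x : S × A) :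
    M.Qval π x = M.expReward x + M.γ * ∫ y, M.Qval π y ∂(M.Pπ π x) := by
  have hr := bddMeas_expReward hR
  have hterm : ∀ k, BddMeas (M.γ ^ k * Rmax)
      (fun y => M.γ ^ k * ∫ z, M.expReward z ∂(M.futureKernel π k y)) := fun k =>
    ⟨(bddMeas_integral_futureKernel π k hr).1.const_mul _, fun y => abs_Qval_term_le hR π k y⟩
  -- Series and integral may be exchanged because the geometric bound `M.γ ^ k * Rmax` is uniform in
  -- the state.
  have hint : ∫ y, M.Qval π y ∂(M.Pπ π x) =
      ∑' k, ∫ y, M.γ ^ k * ∫ z, M.expReward z ∂(M.futureKernel π k y) ∂(M.Pπ π x) := by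
    simp_rw [Qval_eq]
    refine (integral_tsum_of_summable_integral_norm (fun k => (hterm k).integrable _) ?_).symm
    refine Summable.of_nonneg_of_le (fun k => by positivity) (fun k => ?_)
      (M.summable_γ_mul Rmax)
    exact (le_abs_self _).trans ((hterm k).abs.abs_integral_le _)
  rw [hint, Qval_eq, (summable_Qval hR π x).tsum_eq_zero_add, ← tsum_mul_left]
  congr 1
  · simp only [futureKernel, pow_zero, one_mul, Kernel.id_apply]
    exact integral_dirac' _ _ hr.1.stronglyMeasurable
  · refine tsum_congr fun k => ?_
    rw [← future_dirac, future_succ_dirac, integral_const_mul,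
      ← Kernel.comp_apply, Kernel.integral_comp (hr.integrable _)]
    ring

lemma isOptimalValue_bellman (hR : ∀ x s', |M.R x s'| ≤ Rmax) {Q : S × A → ℝ}
    (hQ : M.IsOptimalValue Q) {π : Policy S A} (hπ : IsGreedy Q π) (x : S × A) :
    Q x = M.expReward x + M.γ * ∫ y, Q y ∂(M.Pπ π x) := by
  obtain ⟨⟨L, hL⟩, hB⟩ := hQ
  -- The greedy policy attains the supremum, so the real `⨆` is a genuine maximum and is measurable
  -- in `s`.
  have hsup : ∀ s, ⨆ a, Q (s, a) = Q (s, π.1 s) := fun s => by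
    have : Nonempty A := ⟨π.1 s⟩
    exact le_antisymm (ciSup_le (hπ s))
      (le_ciSup (f := fun a => Q (s, a)) ⟨Q (s, π.1 s), by rintro _ ⟨a, rfl⟩; exact hπ s a⟩ (π.1 s))
  have hRm : BddMeas Rmax (M.R x) := ⟨M.measurable_R.comp measurable_prodMk_left, hR x⟩
  have hQm : BddMeas L (fun s => Q (s, π.1 s)) :=
    ⟨hL.1.comp (measurable_graph π), fun s => hL.2 _⟩
  conv_lhs => rw [← hB]
  simp_rw [bellmanOpt, hsup]
  rw [integral_add (hRm.integrable _) ((hQm.integrable _).const_mul _), integral_const_mul,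
    M.integral_Pπ π hL.1, expReward]

/-- Optimal values dominate the values of all policies. -/
lemma Qval_le_of_isOptimalValue (hR : ∀ x s', |M.R x s'| ≤ Rmax) {Q : S × A → ℝ}
    (hQ : M.IsOptimalValue Q) {πstar : Policy S A} (hπ : IsGreedy Q πstar) (π : Policy S A)
    (x : S × A) : M.Qval π x ≤ Q x := by
  obtain ⟨L, hL⟩ := hQ.1
  have hV := bddMeas_Qval hR π
  -- `Q^π - Q` is a bounded sub-solution with inhomogeneity `0`, hence nonpositive.
  have h := le_div_of_le_discounted (fun x => M.Pπ π x) M.γ_pos.le M.γ_lt_one (c := 0)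
    (hV.sub hL) (fun x => ?_) x
  · simpa using h
  · rw [Qval_bellman hR π x, isOptimalValue_bellman hR hQ hπ x,
      integral_sub (hV.integrable _) (hL.integrable _)]
    have := mul_le_mul_of_nonneg_left (M.integral_Pπ_le_of_isGreedy hL hπ π x) M.γ_pos.le
    linarith

lemma isOptimalValue_le (hR : ∀ x s', |M.R x s'| ≤ Rmax) {Q : S × A → ℝ}
    (hQ : M.IsOptimalValue Q) {π : Policy S A} (hπ : IsGreedy Q π) (x : S × A) :
    Q x ≤ Rmax / (1 - M.γ) := by
  obtain ⟨L, hL⟩ := hQ.1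
  refine le_div_of_le_discounted (fun x => M.Pπ π x) M.γ_pos.le M.γ_lt_one hL (fun x => ?_) x
  rw [isOptimalValue_bellman hR hQ hπ x]
  linarith [le_abs_self (M.expReward x), (bddMeas_expReward hR).2 x]

end MDP

end MTRL

/-! ### Change of measure and unrolling of sub-solutions -/

namespace MTRL

/-- Jensen for the positive part: pointwise real inequalities can be truncated at `0` and continued
in `ℝ≥0∞`, where no summability is at stake. -/
lemma ofReal_integral_le_lintegral_ofReal {X : Type*} [MeasurableSpace X] {μ : Measure X}
    {f : X → ℝ} (hf : Integrable f μ) :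
    ENNReal.ofReal (∫ x, f x ∂μ) ≤ ∫⁻ x, ENNReal.ofReal (f x) ∂μ := by
  rw [integral_eq_lintegral_pos_part_sub_lintegral_neg_part hf]
  refine (ENNReal.ofReal_le_ofReal (sub_le_self _ ENNReal.toReal_nonneg)).trans ?_
  exact ENNReal.ofReal_toReal_le

/-- Change of measure by the Cauchy–Schwarz inequality. -/
lemma lintegral_abs_le_conc_mul {X : Type*} [MeasurableSpace X] {μ ν : Measure X}
    [IsProbabilityMeasure μ] [IsProbabilityMeasure ν] (h : conc μ ν ≠ ⊤) {f : X → ℝ}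
    (hf : Measurable f) :
    ∫⁻ x, ENNReal.ofReal |f x| ∂μ ≤ conc μ ν * eLpNorm f 2 ν := by
  have hac : μ ≪ ν := by
    by_contra hn
    exact h (by simp [conc, hn])
  rw [conc, if_pos hac, eLpNorm_eq_lintegral_rpow_enorm_toReal two_ne_zero ENNReal.ofNat_ne_top,
    ← lintegral_rnDeriv_mul hac (by fun_prop)]
  have hcs := ENNReal.lintegral_mul_le_Lp_mul_Lq ν Real.HolderConjugate.two_two
    (Measure.measurable_rnDeriv μ ν).aemeasurable
    (g := fun x => ENNReal.ofReal |f x|) (by fun_prop)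
  simpa [← ofReal_norm] using hcs

namespace MDP

variable {S A : Type*} [MeasurableSpace S] [MeasurableSpace A] {M : MDP S A}

/-- Unrolling a discounted sub-solution along the trajectories of a policy. -/
lemma lintegral_le_tsum_future {π : Policy S A} {c B : ℝ≥0∞} (hc : c < 1) (hB : B ≠ ⊤)
    {h g : S × A → ℝ≥0∞} (hh : Measurable h) (hg : Measurable g) (hhB : ∀ x, h x ≤ B)
    (hle : ∀ x, h x ≤ g x + c * ∫⁻ y, h y ∂(M.Pπ π x)) (μ : Measure (S × A))
    [IsProbabilityMeasure μ] :
    ∫⁻ x, h x ∂μ ≤ ∑' m : ℕ, c ^ m * ∫⁻ x, g x ∂(M.future π m μ) := by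
  -- Finite unrolling with remainder; the bound `B` forces the remainder to vanish as `n` grows.
  have hn : ∀ n : ℕ, ∫⁻ x, h x ∂μ ≤
      ∑ m ∈ Finset.range n, c ^ m * ∫⁻ x, g x ∂(M.future π m μ)
        + c ^ n * ∫⁻ x, h x ∂(M.future π n μ) := by
    intro n
    induction n with
    | zero => simp [future_zero]
    | succ n ih =>
      refine ih.trans ?_
      rw [Finset.sum_range_succ, add_assoc]
      gcongr
      rw [M.lintegral_future_succ π n μ hh, pow_succ, mul_assoc, ← mul_add]
      gcongr
      calc ∫⁻ x, h x ∂(M.future π n μ)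
          ≤ ∫⁻ x, (g x + c * ∫⁻ y, h y ∂(M.Pπ π x)) ∂(M.future π n μ) := lintegral_mono hle
        _ = _ := by
          rw [lintegral_add_left hg, lintegral_const_mul _ hh.lintegral_kernel]
  have hlim : Filter.Tendsto (fun n : ℕ =>
      (∑' m : ℕ, c ^ m * ∫⁻ x, g x ∂(M.future π m μ)) + c ^ n * B) Filter.atTop
      (nhds ((∑' m : ℕ, c ^ m * ∫⁻ x, g x ∂(M.future π m μ)) + 0 * B)) :=
    tendsto_const_nhds.add (ENNReal.Tendsto.mul_const
      (ENNReal.tendsto_pow_atTop_nhds_zero_of_lt_one hc) (Or.inr hB))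
  rw [zero_mul, add_zero] at hlim
  refine ge_of_tendsto' hlim fun n => (hn n).trans ?_
  gcongr
  · exact ENNReal.sum_le_tsum _
  · calc ∫⁻ x, h x ∂(M.future π n μ) ≤ ∫⁻ _, B ∂(M.future π n μ) := lintegral_mono hhB
      _ = B := by simp

/-- The total concentrability of one policy-iteration step, `j` optimal steps before the end. -/
noncomputable def stepConc (M : MDP S A) (πstar : Policy S A) (ρ ν : Measure (S × A)) (j : ℕ)
    (π₁ π₀ : Policy S A) : ℝ≥0∞ :=
  (∑' m : ℕ, ENNReal.ofReal M.γ ^ m * M.cPI1 πstar ρ ν j (m + 1) π₁)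
    + (∑' m : ℕ, ENNReal.ofReal M.γ ^ (m + 1) * M.cPI2 πstar ρ ν j (m + 1) π₁ π₀)
    + M.cPI3 πstar ρ ν (j + 1)

/-! ### One step of approximate policy iteration -/

section Step

variable {Rmax L : ℝ} {Q : S × A → ℝ} {π₀ π₁ : Policy S A}

/-- The corrected value gap of two successive policies is a discounted sub-solution. -/
lemma value_gap_le (hR : ∀ x s', |M.R x s'| ≤ Rmax) (hQ : BddMeas L Q) (hπ : IsGreedy Q π₁)
    (x : S × A) :
    M.Qval π₀ x - M.Qval π₁ x + (Q x - M.Qval π₀ x) ≤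
      |Q x - M.Qval π₀ x| + M.γ * ∫ y, |Q y - M.Qval π₀ y| ∂(M.Pπ π₀ x)
        + M.γ * ∫ y, (M.Qval π₀ y - M.Qval π₁ y + (Q y - M.Qval π₀ y)) ∂(M.Pπ π₁ x) := by
  have h₀ := bddMeas_Qval hR π₀
  have h₁ := bddMeas_Qval hR π₁
  have hgr := M.integral_Pπ_le_of_isGreedy hQ hπ π₀ x
  have habs : -∫ y, |Q y - M.Qval π₀ y| ∂(M.Pπ π₀ x) ≤
      ∫ y, (Q y - M.Qval π₀ y) ∂(M.Pπ π₀ x) := by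
    rw [← integral_neg]
    exact integral_mono ((hQ.sub h₀).abs.integrable _).neg ((hQ.sub h₀).integrable _)
      fun y => neg_abs_le _
  rw [integral_sub (hQ.integrable _) (h₀.integrable _)] at habs
  rw [integral_add ((h₀.sub h₁).integrable _) ((hQ.sub h₀).integrable _),
    integral_sub (h₀.integrable _) (h₁.integrable _),
    integral_sub (hQ.integrable _) (h₀.integrable _)]
  have b₀ := Qval_bellman hR π₀ x
  have b₁ := Qval_bellman hR π₁ x
  have := le_abs_self (Q x - M.Qval π₀ x)
  have g₁ := mul_le_mul_of_nonneg_left hgr M.γ_pos.le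
  have g₂ := mul_le_mul_of_nonneg_left habs M.γ_pos.le
  linarith

/-- Insert `V₀` under `P*`, then use greediness in the form `P* V₀ ≤ P₁ Q + P*|Q - V₀|`. The middle
integrand is `Q - V₁`, written so as to match `value_gap_le`. -/
lemma optimality_gap_le (hR : ∀ x s', |M.R x s'| ≤ Rmax) (hQ : BddMeas L Q)
    (hπ : IsGreedy Q π₁) {Qstar : S × A → ℝ} (hQstar : M.IsOptimalValue Qstar)
    {πstar : Policy S A} (hπstar : IsGreedy Qstar πstar) (x : S × A) :
    Qstar x - M.Qval π₁ x ≤ M.γ * ∫ y, (Qstar y - M.Qval π₀ y) ∂(M.Pπ πstar x)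
      + M.γ * ∫ y, (M.Qval π₀ y - M.Qval π₁ y + (Q y - M.Qval π₀ y)) ∂(M.Pπ π₁ x)
      + M.γ * ∫ y, |Q y - M.Qval π₀ y| ∂(M.Pπ πstar x) := by
  obtain ⟨L', hL'⟩ := hQstar.1
  have h₀ := bddMeas_Qval hR π₀
  have h₁ := bddMeas_Qval hR π₁
  have hgr := M.integral_Pπ_le_of_isGreedy hQ hπ πstar x
  have habs : -∫ y, |Q y - M.Qval π₀ y| ∂(M.Pπ πstar x) ≤
      ∫ y, (Q y - M.Qval π₀ y) ∂(M.Pπ πstar x) := by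
    rw [← integral_neg]
    exact integral_mono ((hQ.sub h₀).abs.integrable _).neg ((hQ.sub h₀).integrable _)
      fun y => neg_abs_le _
  rw [integral_sub (hQ.integrable _) (h₀.integrable _)] at habs
  rw [integral_add ((h₀.sub h₁).integrable _) ((hQ.sub h₀).integrable _),
    integral_sub (h₀.integrable _) (h₁.integrable _),
    integral_sub (hQ.integrable _) (h₀.integrable _),
    integral_sub (hL'.integrable _) (h₀.integrable _)]
  have b₀ := isOptimalValue_bellman hR hQstar hπstar x
  have b₁ := Qval_bellman hR π₁ x
  have g₁ := mul_le_mul_of_nonneg_left hgr M.γ_pos.le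
  have g₂ := mul_le_mul_of_nonneg_left habs M.γ_pos.le
  linarith

/-- No weight `γ^m` vanishes. Finiteness of each coefficient is needed because `⊤ * 0 = 0` would
make the change of measure false for a vanishing error norm. -/
lemma stepConc_terms_ne_top {πstar : Policy S A} {ρ ν : Measure (S × A)} {j : ℕ}
    (h : M.stepConc πstar ρ ν j π₁ π₀ ≠ ⊤) :
    (∀ m, M.cPI1 πstar ρ ν j (m + 1) π₁ ≠ ⊤) ∧ (∀ m, M.cPI2 πstar ρ ν j (m + 1) π₁ π₀ ≠ ⊤) ∧
      M.cPI3 πstar ρ ν (j + 1) ≠ ⊤ := by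
  rw [stepConc, ENNReal.add_ne_top, ENNReal.add_ne_top] at h
  have hγ : ∀ m, ENNReal.ofReal M.γ ^ m ≠ 0 := fun m =>
    pow_ne_zero _ (by simpa using M.γ_pos)
  refine ⟨fun m => ?_, fun m => ?_, h.2⟩
  · intro ht
    exact ENNReal.ne_top_of_tsum_ne_top h.1.1 m (by rw [ht, ENNReal.mul_top (hγ m)])
  · intro ht
    exact ENNReal.ne_top_of_tsum_ne_top h.1.2 m (by rw [ht, ENNReal.mul_top (hγ (m + 1))])

/-- One step of approximate policy iteration, in expectation. -/
lemma lintegral_optimality_gap_le (hR : ∀ x s', |M.R x s'| ≤ Rmax) (hQ : BddMeas L Q)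
    (hπ : IsGreedy Q π₁) {Qstar : S × A → ℝ} (hQstar : M.IsOptimalValue Qstar)
    {πstar : Policy S A} (hπstar : IsGreedy Qstar πstar) (ρ ν : Measure (S × A))
    [IsProbabilityMeasure ρ] [IsProbabilityMeasure ν] (j : ℕ)
    (hfin : M.stepConc πstar ρ ν j π₁ π₀ ≠ ⊤) :
    ∫⁻ x, ENNReal.ofReal (Qstar x - M.Qval π₁ x) ∂(M.future πstar j ρ) ≤
      ENNReal.ofReal M.γ *
          ∫⁻ x, ENNReal.ofReal (Qstar x - M.Qval π₀ x) ∂(M.future πstar (j + 1) ρ)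
        + ENNReal.ofReal M.γ * (M.stepConc πstar ρ ν j π₁ π₀ *
          eLpNorm (fun x => Q x - M.Qval π₀ x) 2 ν) := by
  obtain ⟨hc1, hc2, hc3⟩ := stepConc_terms_ne_top hfin
  obtain ⟨L', hL'⟩ := hQstar.1
  have h₀ := bddMeas_Qval hR π₀
  have h₁ := bddMeas_Qval hR π₁
  have hγ := M.γ_pos.le
  set c := ENNReal.ofReal M.γ with hcdef
  have hc : c < 1 := by rw [hcdef, ENNReal.ofReal_lt_one]; exact M.γ_lt_one
  have hgap := (h₀.sub h₁).add (hQ.sub h₀)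
  have herr := hQ.sub h₀
  have hopt := hL'.sub h₀
  set h : S × A → ℝ := fun x => M.Qval π₀ x - M.Qval π₁ x + (Q x - M.Qval π₀ x) with hhdef
  set e : S × A → ℝ := fun x => Q x - M.Qval π₀ x with hedef
  set N := eLpNorm e 2 ν with hN
  have he : Measurable fun x => ENNReal.ofReal |e x| := herr.1.abs.ennreal_ofReal
  have hh : Measurable fun x => ENNReal.ofReal (h x) := hgap.1.ennreal_ofReal
  have ho : Measurable fun x => ENNReal.ofReal (Qstar x - M.Qval π₀ x) := hopt.1.ennreal_ofReal
  set μ := M.future πstar j ρ with hμ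
  have hmul : ∀ (f : S × A → ℝ) (L : ℝ), BddMeas L f → ∀ (κ : Measure (S × A))
      [IsProbabilityMeasure κ], ENNReal.ofReal (M.γ * ∫ y, f y ∂κ) ≤
        c * ∫⁻ y, ENNReal.ofReal (f y) ∂κ := by
    intro f L hf κ _
    rw [ENNReal.ofReal_mul hγ]
    gcongr
    exact ofReal_integral_le_lintegral_ofReal (hf.integrable _)
  have hsub : ∀ x, ENNReal.ofReal (h x) ≤
      (ENNReal.ofReal |e x| + c * ∫⁻ y, ENNReal.ofReal |e y| ∂(M.Pπ π₀ x))
        + c * ∫⁻ y, ENNReal.ofReal (h y) ∂(M.Pπ π₁ x) := by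
    intro x
    refine (ENNReal.ofReal_le_ofReal (value_gap_le hR hQ hπ x)).trans ?_
    refine ENNReal.ofReal_add_le.trans (add_le_add (ENNReal.ofReal_add_le.trans ?_) ?_)
    · exact add_le_add le_rfl (hmul _ _ herr.abs _)
    · exact hmul _ _ hgap _
  have hmain : ∀ x, ENNReal.ofReal (Qstar x - M.Qval π₁ x) ≤
      c * ∫⁻ y, ENNReal.ofReal (Qstar y - M.Qval π₀ y) ∂(M.Pπ πstar x)
        + c * ∫⁻ y, ENNReal.ofReal (h y) ∂(M.Pπ π₁ x)
        + c * ∫⁻ y, ENNReal.ofReal |e y| ∂(M.Pπ πstar x) := by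
    intro x
    refine (ENNReal.ofReal_le_ofReal
      (optimality_gap_le (π₀ := π₀) hR hQ hπ hQstar hπstar x)).trans ?_
    refine ENNReal.ofReal_add_le.trans (add_le_add (ENNReal.ofReal_add_le.trans
      (add_le_add ?_ ?_)) ?_)
    · exact hmul _ _ hopt _
    · exact hmul _ _ hgap _
    · exact hmul _ _ herr.abs _
  -- The unrolling starts after one step of `π₁`, hence the index `m + 1`. The source `|e|` yields
  -- `cPI1`; the source `c P₀|e|` yields `cPI2` and the extra factor `c`.
  have hseries : ∫⁻ x, ENNReal.ofReal (h x) ∂(M.future π₁ 1 μ) ≤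
      (∑' m : ℕ, c ^ m * M.cPI1 πstar ρ ν j (m + 1) π₁) * N
        + (∑' m : ℕ, c ^ (m + 1) * M.cPI2 πstar ρ ν j (m + 1) π₁ π₀) * N := by
    refine (lintegral_le_tsum_future hc ENNReal.ofReal_ne_top hh
      (he.add (he.lintegral_kernel.const_mul c))
      (fun x => ENNReal.ofReal_le_ofReal ((le_abs_self _).trans (hgap.2 x))) hsub _).trans ?_
    rw [← ENNReal.tsum_mul_right, ← ENNReal.tsum_mul_right, ← ENNReal.tsum_add]
    refine ENNReal.tsum_le_tsum fun m => ?_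
    have hfut : M.future π₁ m (M.future π₁ 1 μ) = M.future π₁ (m + 1) μ := by
      rw [future_one, future_succ]
    rw [hfut, Pi.add_def, lintegral_add_left he, lintegral_const_mul _ he.lintegral_kernel,
      mul_add, pow_succ, mul_assoc, mul_assoc, mul_assoc]
    gcongr
    · exact lintegral_abs_le_conc_mul (hc1 m) herr.1
    · have := lintegral_abs_le_conc_mul (hc2 m) herr.1
      rw [M.lintegral_future_one π₀ _ he] at this
      exact this
  calc ∫⁻ x, ENNReal.ofReal (Qstar x - M.Qval π₁ x) ∂μ
      ≤ ∫⁻ x, (c * ∫⁻ y, ENNReal.ofReal (Qstar y - M.Qval π₀ y) ∂(M.Pπ πstar x)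
        + c * ∫⁻ y, ENNReal.ofReal (h y) ∂(M.Pπ π₁ x)
        + c * ∫⁻ y, ENNReal.ofReal |e y| ∂(M.Pπ πstar x)) ∂μ := lintegral_mono hmain
    _ = c * ∫⁻ x, ENNReal.ofReal (Qstar x - M.Qval π₀ x) ∂(M.future πstar (j + 1) ρ)
        + c * ∫⁻ x, ENNReal.ofReal (h x) ∂(M.future π₁ 1 μ)
        + c * ∫⁻ x, ENNReal.ofReal |e x| ∂(M.future πstar (j + 1) ρ) := by
      rw [lintegral_add_right _ (he.lintegral_kernel.const_mul c),
        lintegral_add_right _ (hh.lintegral_kernel.const_mul c),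
        lintegral_const_mul _ ho.lintegral_kernel, lintegral_const_mul _ hh.lintegral_kernel,
        lintegral_const_mul _ he.lintegral_kernel, M.lintegral_future_succ πstar j ρ ho,
        M.lintegral_future_succ πstar j ρ he, M.lintegral_future_one π₁ μ hh]
    _ ≤ _ := by
      rw [add_assoc, ← mul_add, stepConc, add_mul, add_mul]
      gcongr
      exact lintegral_abs_le_conc_mul hc3 herr.1

end Step

/-- Error propagation of approximate policy iteration for one task. -/
lemma eLpNorm_optimality_gap_le {Rmax L : ℝ} (hR : ∀ x s', |M.R x s'| ≤ Rmax)
    {Qstar : S × A → ℝ} (hQstar : M.IsOptimalValue Qstar) {πstar : Policy S A}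
    (hπstar : IsGreedy Qstar πstar) (ρ ν : Measure (S × A)) [IsProbabilityMeasure ρ]
    [IsProbabilityMeasure ν] (K : ℕ) (Q : ℕ → S × A → ℝ) (hQ : ∀ k < K, BddMeas L (Q k))
    (π : ℕ → Policy S A) (hπ : ∀ k < K, IsGreedy (Q k) (π (k + 1)))
    (hfin : ∀ k < K, M.stepConc πstar ρ ν (K - k - 1) (π (k + 1)) (π k) ≠ ⊤) :
    eLpNorm (fun x => Qstar x - M.Qval (π K) x) 1 ρ ≤
      ∑ k ∈ Finset.range K, ENNReal.ofReal M.γ ^ (K - k) *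
          (M.stepConc πstar ρ ν (K - k - 1) (π (k + 1)) (π k) *
            eLpNorm (fun x => Q k x - M.Qval (π k) x) 2 ν)
        + ENNReal.ofReal M.γ ^ K * ENNReal.ofReal (2 * Rmax / (1 - M.γ)) := by
  -- The gap after `n` iterations is measured `K - n` optimal steps ahead of `ρ`; each iteration
  -- consumes one of them, so `n = K` leaves `ρ` itself.
  have hn : ∀ n ≤ K, ∫⁻ x, ENNReal.ofReal (Qstar x - M.Qval (π n) x)
      ∂(M.future πstar (K - n) ρ) ≤
        ∑ k ∈ Finset.range n, ENNReal.ofReal M.γ ^ (n - k) *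
          (M.stepConc πstar ρ ν (K - k - 1) (π (k + 1)) (π k) *
            eLpNorm (fun x => Q k x - M.Qval (π k) x) 2 ν)
        + ENNReal.ofReal M.γ ^ n * ENNReal.ofReal (2 * Rmax / (1 - M.γ)) := by
    intro n
    induction n with
    | zero =>
      intro _
      simp only [Finset.range_zero, Finset.sum_empty, pow_zero, one_mul, zero_add]
      calc _ ≤ ∫⁻ _, ENNReal.ofReal (2 * Rmax / (1 - M.γ)) ∂(M.future πstar (K - 0) ρ) := by
            refine lintegral_mono fun x => ENNReal.ofReal_le_ofReal ?_
            have h1 := isOptimalValue_le hR hQstar hπstar x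
            have h2 := neg_le_of_abs_le ((bddMeas_Qval hR (π 0)).2 x)
            rw [mul_div_assoc]
            linarith
        _ = _ := by simp
    | succ n ih =>
      intro hnK
      have hlt : n < K := hnK
      have hstep := lintegral_optimality_gap_le hR (hQ n hlt) (hπ n hlt) hQstar hπstar ρ ν
        (K - n - 1) (hfin n hlt)
      rw [show K - n - 1 + 1 = K - n by omega] at hstep
      rw [show K - (n + 1) = K - n - 1 by omega]
      refine hstep.trans ((add_le_add_left (mul_le_mul_right (ih hlt.le) _) _).trans ?_)
      rw [Finset.sum_range_succ, mul_add, Finset.mul_sum, pow_succ',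
        show n + 1 - n = 1 by omega, pow_one, mul_assoc, add_right_comm]
      refine add_le_add (add_le_add (Finset.sum_le_sum fun k hk => le_of_eq ?_) le_rfl) le_rfl
      rw [← mul_assoc, ← pow_succ', show n - k + 1 = n + 1 - k by
        have := Finset.mem_range.1 hk; omega]
  have hK := hn K le_rfl
  rw [Nat.sub_self, future_zero] at hK
  refine le_of_eq_of_le ?_ hK
  rw [eLpNorm_one_eq_lintegral_enorm]
  refine lintegral_congr fun x => ?_
  -- Optimality makes the gap nonnegative, so its positive part is its absolute value.
  rw [← ofReal_norm, Real.norm_of_nonneg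
    (sub_nonneg.2 (Qval_le_of_isOptimalValue hR hQstar hπstar (π K) x))]

end MDP

end MTRL

/-! ### The weights and inequalities for square roots -/

namespace MTRL

lemma alpha_of_lt {x : ℝ} {K k : ℕ} (hk : k < K) :
    alpha x K k = (1 - x) * (x ^ (K - k - 1) / (1 - x ^ (K + 1))) := by
  rw [alpha, if_pos hk, mul_div_assoc]

lemma alpha_pos {x : ℝ} (h0 : 0 < x) (h1 : x < 1) {K k : ℕ} (hk : k < K) : 0 < alpha x K k := by
  rw [alpha_of_lt hk]
  have := pow_lt_one₀ h0.le h1 (Nat.add_one_ne_zero K)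
  exact mul_pos (by linarith) (div_pos (by positivity) (by linarith))

/-- The two sides differ exactly by the factor `1 / (1 - x ^ (K + 1)) ≥ 1`. -/
lemma pow_le_mul_alpha {x : ℝ} (h0 : 0 < x) (h1 : x < 1) {K k : ℕ} (hk : k < K) :
    x ^ (K - k) ≤ x / (1 - x) * alpha x K k := by
  have hp := pow_lt_one₀ h0.le h1 (Nat.add_one_ne_zero K)
  have hp0 := pow_pos h0 (K + 1)
  have hx : 1 - x ≠ 0 := by linarith
  obtain ⟨j, hj⟩ : ∃ j, K - k = j + 1 := ⟨K - k - 1, by omega⟩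
  rw [alpha_of_lt hk, ← mul_assoc, div_mul_cancel₀ _ hx, hj, Nat.add_sub_cancel, pow_succ',
    ← mul_div_assoc]
  exact le_div_self (by positivity) (by linarith) (by linarith)

/-- The weight `α_k(x)` may decrease in the discount factor `x`, but not faster than the factor
`x / (1 - x) ^ 2` grows. -/
lemma div_sq_mul_alpha_rpow_mono {x y r : ℝ} (h0 : 0 < x) (hxy : x ≤ y) (h1 : y < 1)
    (hr : r ∈ Icc (0 : ℝ) 1) {K k : ℕ} (hk : k < K) :
    2 * x / (1 - x) ^ 2 * alpha x K k ^ r ≤ 2 * y / (1 - y) ^ 2 * alpha y K k ^ r := by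
  -- Merging the powers of `1 - z` leaves the exponent `r - 2 < 0`, so every factor becomes
  -- increasing in `z`.
  have hsplit : ∀ z : ℝ, 0 < z → z < 1 → 2 * z / (1 - z) ^ 2 * alpha z K k ^ r =
      2 * z * (1 - z) ^ (r - 2) * (z ^ (K - k - 1) / (1 - z ^ (K + 1))) ^ r := by
    intro z hz0 hz1
    have := pow_lt_one₀ hz0.le hz1 (Nat.add_one_ne_zero K)
    rw [alpha_of_lt hk, Real.mul_rpow (by linarith) (div_nonneg (by positivity) (by linarith)),
      Real.rpow_sub (by linarith), Real.rpow_two]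
    ring
  have hy0 : 0 < y := h0.trans_le hxy
  have hx := pow_lt_one₀ h0.le (hxy.trans_lt h1) (Nat.add_one_ne_zero K)
  have hy := pow_lt_one₀ hy0.le h1 (Nat.add_one_ne_zero K)
  have hpow : x ^ (K + 1) ≤ y ^ (K + 1) := by gcongr
  rw [hsplit x h0 (hxy.trans_lt h1), hsplit y hy0 h1]
  have hneg : (1 - x) ^ (r - 2) ≤ (1 - y) ^ (r - 2) :=
    Real.rpow_le_rpow_of_nonpos (by linarith) (by linarith) (by linarith [hr.2])
  have hfrac : x ^ (K - k - 1) / (1 - x ^ (K + 1)) ≤ y ^ (K - k - 1) / (1 - y ^ (K + 1)) := by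
    apply div_le_div₀ (by positivity) (by gcongr) (by linarith) (by linarith)
  have hx0 : 0 ≤ x ^ (K - k - 1) / (1 - x ^ (K + 1)) :=
    div_nonneg (by positivity) (by linarith)
  have hn0 : 0 ≤ (1 - x) ^ (r - 2) := Real.rpow_nonneg (by linarith) _
  have hn1 : 0 ≤ (1 - y) ^ (r - 2) := Real.rpow_nonneg (by linarith) _
  exact mul_le_mul (mul_le_mul (by linarith) hneg hn0 (by linarith))
    (Real.rpow_le_rpow hx0 hfrac hr.1) (Real.rpow_nonneg hx0 _)
    (mul_nonneg (by linarith) hn1)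

lemma ennreal_sq_rpow_half (a : ℝ≥0∞) : (a ^ 2) ^ (1 / 2 : ℝ) = a := by
  rw [← ENNReal.rpow_natCast, ← ENNReal.rpow_mul]
  norm_num

lemma ennreal_rpow_sq (a : ℝ≥0∞) (r : ℝ) : (a ^ r) ^ 2 = a ^ (2 * r) := by
  rw [← ENNReal.rpow_natCast, ← ENNReal.rpow_mul, mul_comm]
  norm_num

lemma ennreal_sum_mul_le_sqrt_mul_sqrt {ι : Type*} (s : Finset ι) (f g : ι → ℝ≥0∞) :
    ∑ i ∈ s, f i * g i ≤
      (∑ i ∈ s, f i ^ 2) ^ (1 / 2 : ℝ) * (∑ i ∈ s, g i ^ 2) ^ (1 / 2 : ℝ) := by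
  simpa using ENNReal.inner_le_Lp_mul_Lq s f g Real.HolderConjugate.two_two

lemma mul_sqrt_sum (c : ℝ≥0∞) {ι : Type*} (s : Finset ι) (f : ι → ℝ≥0∞) :
    c * (∑ i ∈ s, f i ^ 2) ^ (1 / 2 : ℝ) = (∑ i ∈ s, (c * f i) ^ 2) ^ (1 / 2 : ℝ) := by
  simp_rw [mul_pow]
  rw [← Finset.mul_sum, ENNReal.mul_rpow_of_nonneg _ _ (by norm_num), ennreal_sq_rpow_half]

/-- The average of square roots is at most the square root of the average. -/
lemma avg_sqrt_le_sqrt_avg {T : ℕ} (hT : 0 < T) (E : Fin T → ℝ≥0∞) :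
    (∑ t, E t ^ (1 / 2 : ℝ)) / (T : ℝ≥0∞) ≤ ((∑ t, E t) / (T : ℝ≥0∞)) ^ (1 / 2 : ℝ) := by
  have hT0 : (T : ℝ≥0∞) ≠ 0 := by exact_mod_cast hT.ne'
  have h := ENNReal.rpow_arith_mean_le_arith_mean_rpow Finset.univ
    (fun _ : Fin T => (T : ℝ≥0∞)⁻¹) (fun t => E t ^ (1 / 2 : ℝ))
    (by simp [ENNReal.mul_inv_cancel hT0 (ENNReal.natCast_ne_top T)]) (p := 2) (by norm_num)
  have hE : ∀ t, (E t ^ (1 / 2 : ℝ)) ^ (2 : ℝ) = E t := fun t => by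
    rw [← ENNReal.rpow_mul]; norm_num
  simp_rw [hE, ← Finset.mul_sum, one_div] at h
  rwa [ENNReal.div_eq_inv_mul, ENNReal.div_eq_inv_mul, one_div,
    ENNReal.le_rpow_inv_iff (by norm_num)]

/-! ### Single-task bound through the concentrability constant -/

namespace MDP

variable {S A : Type*} [MeasurableSpace S] [MeasurableSpace A] {M : MDP S A}

/-- The policies of the iteration compete in the supremum. -/
lemma CPI_ge (M : MDP S A) (πstar : Policy S A) (ρ ν : Measure (S × A)) (K : ℕ) (r : ℝ)
    (π : ℕ → Policy S A) :
    ENNReal.ofReal (((1 - M.γ) / 2) ^ 2) * ∑ k ∈ Finset.range K,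
      ENNReal.ofReal (alpha M.γ K k) ^ (2 * (1 - r)) *
        M.stepConc πstar ρ ν (K - k - 1) (π (k + 1)) (π k) ^ 2 ≤ M.CPI πstar ρ ν K r := by
  rw [CPI]
  gcongr
  refine le_of_eq_of_le ?_ (le_iSup _ (fun i : Fin (K + 1) => π i))
  rw [Finset.sum_range]
  refine Finset.sum_congr rfl fun k _ => ?_
  rw [stepConc, show K - (k : ℕ) - 1 + 1 = K - k by omega]
  simp

/-- The prefactor and all weights `alpha` are positive, so one infinite term would make `CPI`
infinite. -/
lemma stepConc_ne_top {πstar : Policy S A} {ρ ν : Measure (S × A)} {K : ℕ} {r : ℝ}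
    (h : M.CPI πstar ρ ν K r ≠ ⊤) (π : ℕ → Policy S A) {k : ℕ} (hk : k < K) :
    M.stepConc πstar ρ ν (K - k - 1) (π (k + 1)) (π k) ≠ ⊤ := by
  have hγ := M.γ_lt_one
  intro ht
  refine h (top_le_iff.1 (le_trans (le_of_eq ?_) (M.CPI_ge πstar ρ ν K r π)))
  have hα := alpha_pos M.γ_pos M.γ_lt_one hk
  rw [eq_comm, ENNReal.mul_eq_top]
  refine Or.inl ⟨?_, ?_⟩
  · have : 0 < ((1 - M.γ) / 2) ^ 2 := by
      have : 0 < 1 - M.γ := by linarith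
      positivity
    exact (ENNReal.ofReal_pos.2 this).ne'
  · rw [ENNReal.sum_eq_top]
    refine ⟨k, Finset.mem_range.2 hk, ?_⟩
    rw [ht, ENNReal.top_pow two_ne_zero, ENNReal.mul_top]
    rw [ENNReal.ofReal_rpow_of_pos hα]
    simpa using Real.rpow_pos_of_pos hα _

/-- The factor `2 / (1 - γ)` undoes the normalisation in `CPI`. -/
lemma sqrt_sum_stepConc_le (M : MDP S A) (πstar : Policy S A) (ρ ν : Measure (S × A)) (K : ℕ)
    (r : ℝ) (π : ℕ → Policy S A) :
    (∑ k ∈ Finset.range K, (ENNReal.ofReal (alpha M.γ K k) ^ (1 - r) *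
        M.stepConc πstar ρ ν (K - k - 1) (π (k + 1)) (π k)) ^ 2) ^ (1 / 2 : ℝ) ≤
      ENNReal.ofReal (2 / (1 - M.γ)) * M.CPI πstar ρ ν K r ^ (1 / 2 : ℝ) := by
  have hγ : 0 < 1 - M.γ := by linarith [M.γ_lt_one]
  have h := ENNReal.rpow_le_rpow (M.CPI_ge πstar ρ ν K r π) (z := 1 / 2) (by norm_num)
  rw [ENNReal.mul_rpow_of_nonneg _ _ (by norm_num), ENNReal.ofReal_pow (by positivity),
    ennreal_sq_rpow_half] at h
  simp_rw [mul_pow, ennreal_rpow_sq]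
  refine le_trans (le_of_eq ?_) (mul_le_mul_right h (ENNReal.ofReal (2 / (1 - M.γ))))
  rw [← mul_assoc, ← ENNReal.ofReal_mul (by positivity),
    show 2 / (1 - M.γ) * ((1 - M.γ) / 2) = 1 by field_simp, ENNReal.ofReal_one, one_mul]

/-- The single-task error bound, with the discount factor enlarged to `γ`. -/
lemma eLpNorm_optimality_gap_le_sqrtCPI {Rmax L γ r : ℝ} (hR0 : 0 ≤ Rmax)
    (hR : ∀ x s', |M.R x s'| ≤ Rmax) {Qstar : S × A → ℝ} (hQstar : M.IsOptimalValue Qstar)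
    {πstar : Policy S A} (hπstar : IsGreedy Qstar πstar) (ρ ν : Measure (S × A))
    [IsProbabilityMeasure ρ] [IsProbabilityMeasure ν] {K : ℕ} (hK : 0 < K)
    (Q : ℕ → S × A → ℝ) (hQ : ∀ k < K, BddMeas L (Q k))
    (π : ℕ → Policy S A) (hπ : ∀ k < K, IsGreedy (Q k) (π (k + 1)))
    (hγ : M.γ ≤ γ) (hγ1 : γ < 1) (hr : r ∈ Icc (0 : ℝ) 1) (hfin : M.CPI πstar ρ ν K r ≠ ⊤) :
    eLpNorm (fun x => Qstar x - M.Qval (π K) x) 1 ρ ≤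
      ENNReal.ofReal (2 * γ / (1 - γ) ^ 2) * (M.CPI πstar ρ ν K r ^ (1 / 2 : ℝ) *
        (∑ k ∈ Finset.range K, ENNReal.ofReal (alpha γ K k) ^ (2 * r) *
          eLpNorm (fun x => Q k x - M.Qval (π k) x) 2 ν ^ 2) ^ (1 / 2 : ℝ)
        + ENNReal.ofReal (γ ^ (K - 1) * Rmax)) := by
  have h0 := M.γ_pos
  have h1 := M.γ_lt_one
  have hγ0 : 0 < γ := h0.trans_le hγ
  refine (eLpNorm_optimality_gap_le hR hQstar hπstar ρ ν K Q hQ π hπ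
    fun k hk => stepConc_ne_top hfin π hk).trans ?_
  rw [mul_add]
  set e : ℕ → ℝ≥0∞ := fun k => eLpNorm (fun x => Q k x - M.Qval (π k) x) 2 ν with he
  set D : ℕ → ℝ≥0∞ := fun k => M.stepConc πstar ρ ν (K - k - 1) (π (k + 1)) (π k) with hD
  have hden : 0 < 1 - M.γ := by linarith
  have hden' : 0 < 1 - γ := by linarith
  refine add_le_add ?_ ?_
  · calc ∑ k ∈ Finset.range K, ENNReal.ofReal M.γ ^ (K - k) * (D k * e k)
        ≤ ∑ k ∈ Finset.range K, ENNReal.ofReal (M.γ / (1 - M.γ)) *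
            ((ENNReal.ofReal (alpha M.γ K k) ^ (1 - r) * D k) *
              (ENNReal.ofReal (alpha M.γ K k) ^ r * e k)) := by
          refine Finset.sum_le_sum fun k hk => ?_
          have hk := Finset.mem_range.1 hk
          have hα := alpha_pos h0 h1 hk
          rw [mul_mul_mul_comm, ← ENNReal.rpow_add _ _ (by simpa using hα) ENNReal.ofReal_ne_top,
            sub_add_cancel, ENNReal.rpow_one, ← mul_assoc (ENNReal.ofReal (M.γ / (1 - M.γ))),
            ← ENNReal.ofReal_mul (by positivity), ← ENNReal.ofReal_pow h0.le]
          gcongr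
          exact pow_le_mul_alpha h0 h1 hk
      _ ≤ ENNReal.ofReal (M.γ / (1 - M.γ)) *
            ((ENNReal.ofReal (2 / (1 - M.γ)) * M.CPI πstar ρ ν K r ^ (1 / 2 : ℝ)) *
              (∑ k ∈ Finset.range K,
                (ENNReal.ofReal (alpha M.γ K k) ^ r * e k) ^ 2) ^ (1 / 2 : ℝ)) := by
          rw [← Finset.mul_sum]
          gcongr
          refine (ennreal_sum_mul_le_sqrt_mul_sqrt _ _ _).trans ?_
          gcongr
          exact M.sqrt_sum_stepConc_le πstar ρ ν K r π
      _ = M.CPI πstar ρ ν K r ^ (1 / 2 : ℝ) * (ENNReal.ofReal (2 * M.γ / (1 - M.γ) ^ 2) *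
            (∑ k ∈ Finset.range K,
              (ENNReal.ofReal (alpha M.γ K k) ^ r * e k) ^ 2) ^ (1 / 2 : ℝ)) := by
          rw [show 2 * M.γ / (1 - M.γ) ^ 2 = M.γ / (1 - M.γ) * (2 / (1 - M.γ)) by
            field_simp, ENNReal.ofReal_mul (by positivity)]
          ring
      -- Only the prefactor and the error weights pass to the larger `γ`. The prefactor is moved
      -- inside the root so that monotonicity applies to each product.
      _ ≤ M.CPI πstar ρ ν K r ^ (1 / 2 : ℝ) * (ENNReal.ofReal (2 * γ / (1 - γ) ^ 2) *
            (∑ k ∈ Finset.range K,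
              (ENNReal.ofReal (alpha γ K k) ^ r * e k) ^ 2) ^ (1 / 2 : ℝ)) := by
          refine mul_le_mul_right ?_ _
          rw [mul_sqrt_sum, mul_sqrt_sum]
          gcongr (∑ k ∈ _, ?_ ^ 2) ^ _ with k hk
          have hk := Finset.mem_range.1 hk
          rw [← mul_assoc, ← mul_assoc, ENNReal.ofReal_rpow_of_pos (alpha_pos h0 h1 hk),
            ENNReal.ofReal_rpow_of_pos (alpha_pos hγ0 hγ1 hk),
            ← ENNReal.ofReal_mul (by positivity), ← ENNReal.ofReal_mul (by positivity)]
          exact mul_le_mul_left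
            (ENNReal.ofReal_le_ofReal (div_sq_mul_alpha_rpow_mono h0 hγ hγ1 hr hk)) _
      _ = _ := by
          simp_rw [mul_pow, ennreal_rpow_sq]
          ring
  · rw [← ENNReal.ofReal_pow h0.le, ← ENNReal.ofReal_mul (by positivity),
      ← ENNReal.ofReal_mul (by positivity)]
    refine ENNReal.ofReal_le_ofReal ?_
    have hpow : M.γ ^ K ≤ γ ^ K := by gcongr
    -- A factor `1 / (1 - γ)` is given away to share the prefactor of the error term.
    have hinv : 2 * Rmax / (1 - M.γ) ≤ 2 * Rmax / (1 - γ) ^ 2 := by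
      apply div_le_div_of_nonneg_left (by positivity) (by positivity)
      nlinarith
    calc M.γ ^ K * (2 * Rmax / (1 - M.γ)) ≤ γ ^ K * (2 * Rmax / (1 - γ) ^ 2) := by gcongr
      _ = 2 * γ / (1 - γ) ^ 2 * (γ ^ (K - 1) * Rmax) := by
        obtain ⟨n, rfl⟩ : ∃ n, K = n + 1 := ⟨K - 1, by omega⟩
        rw [Nat.add_sub_cancel, pow_succ]
        ring

end MDP

/-! ### Averaging over the tasks -/

lemma errAvg_epsAvg {T : ℕ} {S A : Fin T → Type*}
    [∀ t, MeasurableSpace (S t)] [∀ t, MeasurableSpace (A t)]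
    (M : ∀ t, MDP (S t) (A t)) (ν : ∀ t, Measure (S t × A t))
    (Q : ∀ t, ℕ → S t × A t → ℝ) (π : ∀ t, ℕ → Policy (S t) (A t)) (γ : ℝ) (K : ℕ) (r : ℝ) :
    errAvg γ K (epsAvg M ν Q π) r =
      (∑ t, ∑ k ∈ Finset.range K, ENNReal.ofReal (alpha γ K k) ^ (2 * r) *
        eLpNorm (fun x => Q t k x - (M t).Qval (π t k) x) 2 (ν t) ^ 2) / (T : ℝ≥0∞) := by
  simp_rw [errAvg, epsAvg, div_eq_mul_inv]
  rw [Finset.sum_comm, Finset.sum_mul]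
  refine Finset.sum_congr rfl fun k _ => ?_
  rw [← Finset.mul_sum, mul_assoc]

end MTRL

/-- The infimum runs over the `r ∈ [0, 1]` with a finite concentrability constant; it is `∞` if
there are none, so an infinite constant makes the bound void even if the errors vanish. -/
theorem theorem5 {T : ℕ} (hT : 0 < T) {S A : Fin T → Type*}
    [∀ t, MeasurableSpace (S t)] [∀ t, MeasurableSpace (A t)]
    (M : ∀ t, MTRL.MDP (S t) (A t))
    (Rmax : Fin T → ℝ) (hR : ∀ t x s', |(M t).R x s'| ≤ Rmax t)
    (ρ ν : ∀ t, MeasureTheory.Measure (S t × A t))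
    [∀ t, MeasureTheory.IsProbabilityMeasure (ρ t)]
    [∀ t, MeasureTheory.IsProbabilityMeasure (ν t)]
    (Qstar : ∀ t, S t × A t → ℝ) (hQstar : ∀ t, (M t).IsOptimalValue (Qstar t))
    (πstar : ∀ t, MTRL.Policy (S t) (A t)) (hπstar : ∀ t, MTRL.IsGreedy (Qstar t) (πstar t))
    (K : ℕ) (hK : 0 < K)
    (Qmax : ℝ) (hQmax : Qmax ≤ (⨆ t, Rmax t) / (1 - MTRL.gammaMax M))
    (Q : ∀ t, ℕ → S t × A t → ℝ) (hQ : ∀ t, ∀ k < K, MTRL.BddMeas Qmax (Q t k))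
    (π : ∀ t, ℕ → MTRL.Policy (S t) (A t))
    (hπ : ∀ t, ∀ k < K, MTRL.IsGreedy (Q t k) (π t (k + 1))) :
    (∑ t, MeasureTheory.eLpNorm (fun x => Qstar t x - (M t).Qval (π t K) x) 1 (ρ t))
        / (T : ENNReal)
      ≤ ENNReal.ofReal (2 * MTRL.gammaMax M / (1 - MTRL.gammaMax M) ^ 2) *
        ((⨅ (r : ℝ) (_ : r ∈ Set.Icc (0 : ℝ) 1) (_ : MTRL.sqrtCPI M πstar ρ ν K r ≠ ⊤),
            MTRL.sqrtCPI M πstar ρ ν K r *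
              (MTRL.errAvg (MTRL.gammaMax M) K (MTRL.epsAvg M ν Q π) r) ^ (1 / 2 : ℝ))
          + ENNReal.ofReal (MTRL.gammaMax M ^ (K - 1) * ((∑ t, Rmax t) / T))) := by
  have : Nonempty (Fin T) := ⟨⟨0, hT⟩⟩
  have hγle : ∀ t, (M t).γ ≤ MTRL.gammaMax M := fun t =>
    le_ciSup (f := fun t => (M t).γ) (Set.finite_range _).bddAbove t
  have hγ1 : MTRL.gammaMax M < 1 := by
    obtain ⟨t, ht⟩ := exists_eq_ciSup_of_finite (f := fun t => (M t).γ)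
    rw [MTRL.gammaMax, ← ht]
    exact (M t).γ_lt_one
  have hγ0 : 0 < MTRL.gammaMax M := (M ⟨0, hT⟩).γ_pos.trans_le (hγle _)
  have hR0 : ∀ t, 0 ≤ Rmax t := fun t => by
    obtain ⟨x⟩ := MeasureTheory.nonempty_of_isProbabilityMeasure (ρ t)
    exact (abs_nonneg _).trans (hR t x x.1)
  set γ := MTRL.gammaMax M with hγ
  have hT0 : (0 : ℝ) < T := by exact_mod_cast hT
  have hc : 0 < 2 * γ / (1 - γ) ^ 2 := by
    have : 0 < 1 - γ := by linarith
    positivity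
  have hc0 : ENNReal.ofReal (2 * γ / (1 - γ) ^ 2) ≠ 0 := by simpa using hc
  -- Prefactor and reward term are moved to the left so that the infimum stands alone and can be
  -- tested at each `r`.
  rw [mul_comm, ← ENNReal.div_le_iff hc0 ENNReal.ofReal_ne_top, ← tsub_le_iff_right]
  refine le_iInf₂ fun r hr => le_iInf fun hfin => ?_
  rw [tsub_le_iff_right, ENNReal.div_le_iff hc0 ENNReal.ofReal_ne_top, mul_comm]
  set C := MTRL.sqrtCPI M πstar ρ ν K r with hC
  set E : Fin T → ENNReal := fun t => ∑ k ∈ Finset.range K,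
    ENNReal.ofReal (MTRL.alpha γ K k) ^ (2 * r) *
      MeasureTheory.eLpNorm (fun x => Q t k x - (M t).Qval (π t k) x) 2 (ν t) ^ 2 with hE
  have hCt : ∀ t, (M t).CPI (πstar t) (ρ t) (ν t) K r ^ (1 / 2 : ℝ) ≤ C := fun t =>
    le_iSup (fun t => (M t).CPI (πstar t) (ρ t) (ν t) K r ^ (1 / 2 : ℝ)) t
  have htask : ∀ t, MeasureTheory.eLpNorm (fun x => Qstar t x - (M t).Qval (π t K) x) 1 (ρ t) ≤
      ENNReal.ofReal (2 * γ / (1 - γ) ^ 2) *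
        (C * E t ^ (1 / 2 : ℝ) + ENNReal.ofReal (γ ^ (K - 1) * Rmax t)) := by
    intro t
    have hfint : (M t).CPI (πstar t) (ρ t) (ν t) K r ≠ ⊤ := fun h => by
      have := hCt t
      rw [h, ENNReal.top_rpow_of_pos (by norm_num), top_le_iff] at this
      exact hfin this
    refine (MTRL.MDP.eLpNorm_optimality_gap_le_sqrtCPI (hR0 t) (hR t) (hQstar t) (hπstar t) (ρ t)
      (ν t) hK (Q t) (hQ t) (π t) (hπ t) (hγle t) hγ1 hr hfint).trans ?_
    gcongr
    exact hCt t
  calc _ ≤ (∑ t, ENNReal.ofReal (2 * γ / (1 - γ) ^ 2) *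
        (C * E t ^ (1 / 2 : ℝ) + ENNReal.ofReal (γ ^ (K - 1) * Rmax t))) / (T : ENNReal) := by
        gcongr with t
        exact htask t
    _ = ENNReal.ofReal (2 * γ / (1 - γ) ^ 2) * (C * ((∑ t, E t ^ (1 / 2 : ℝ)) / (T : ENNReal))
        + ENNReal.ofReal (γ ^ (K - 1) * ((∑ t, Rmax t) / T))) := by
        rw [← mul_div_assoc (γ ^ (K - 1)), ENNReal.ofReal_div_of_pos hT0, ENNReal.ofReal_natCast,
          Finset.mul_sum _ Rmax, ENNReal.ofReal_sum_of_nonneg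
            (fun t _ => mul_nonneg (pow_nonneg hγ0.le _) (hR0 t)),
          ← Finset.mul_sum, Finset.sum_add_distrib, ← Finset.mul_sum]
        simp_rw [div_eq_mul_inv]
        ring
    _ ≤ _ := by
        rw [MTRL.errAvg_epsAvg]
        gcongr
        exact MTRL.avg_sqrt_le_sqrt_avg hT E
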